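/- Let $W=[w_{ij}]\in\mathbb{R}^{n\times n}$ be the adjacency matrix, with entries of either sign and $w_{ii}=0$, of a directed signed network $\mathcal G=(\mathcal V,\mathcal E,W)$ on $\mathcal V=\{1,\dots,n\}$, where $(i,j)\in\mathcal E$ if and only if $w_{ij}\neq 0$. Assume that $\mathcal G$ is strongly connected (every node is reachable from every other one along directed edges) and structurally balanced: $\mathcal V$ is the disjoint union of two sets $\mathcal V_1,\mathcal V_2$ such that the edges inside each set have positive weight and the edges between the two sets have negative weight. Let $\mathcal L=[l_{ij}]$ be the signed Laplacian, $l_{ii}=\sum_{m=1}^n w_{im}$ and $l_{ij}=-w_{ij}$ for $i\ne j$, and let $\boldsymbol\delta\in\mathbb{R}^n$ be given by $\delta_i=\sum_{j=1}^n(|w_{ij}|-w_{ij})$. For $\boldsymbol k\in\mathbb{R}^n$ consider the compensated network $$\dot{\boldsymbol x}(t)=-\mathcal L^{\boldsymbol k}\boldsymbol x(t),\qquad t\ge 0,\qquad \mathcal L^{\boldsymbol k}=\mathcal L+\mathrm{diag}(\boldsymbol k).$$ Inequalities between vectors are entrywise. Then the following hold. 1) If $\boldsymbol k\le\boldsymbol\delta$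 and $\boldsymbol k\neq\boldsymbol\delta$, then the compensated network is unstable, i.e. its equilibrium at the origin is not Lyapunov stable. 2) If $\boldsymbol k\ge\boldsymbol\delta$ and $\boldsymbol k\neq\boldsymbol\delta$, then the compensated network achieves trivial consensus, i.e. $\boldsymbol x(t)\to\boldsymbol 0$ as $t\to\infty$ for every initial state $\boldsymbol x(0)\in\mathbb{R}^n$. 3) If there are indices $i'\neq i''$ with $k_{i'}>\delta_{i'}$ and $k_{i''}<\delta_{i''}$, then the compensated network cannot achieve bipartite consensus: for no initial state $\boldsymbol x(0)\in\mathbb{R}^n$ is there an $\alpha>0$ such that $\lim_{t\to\infty}|x_i(t)|=\alpha$ for all $i\in\mathcal V$. -/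

import Mathlib

open Filter Topology

/-- A network on the node set `{1, …, n}`: an edge set and a real adjacency matrix `W` (entries of
either sign) with `W i j ≠ 0` exactly on the edges. There are no self-loops, so that the signed
Laplacian below has zero row sums. No symmetry is imposed. -/
structure SignedNetwork (n : ℕ) where
  edges : Set (Fin n × Fin n)
  W : Matrix (Fin n) (Fin n) ℝ
  mem_edges_iff : ∀ i j, (i, j) ∈ edges ↔ W i j ≠ 0
  no_self_loops : ∀ i, (i, i) ∉ edges

namespace SignedNetwork

variable {n : ℕ}

/-- Any two nodes are joined by a directed path (in both directions, as `i`, `j` are arbitrary). -/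
def StronglyConnected (G : SignedNetwork n) : Prop :=
  ∀ i j, Relation.ReflTransGen (fun a b => (a, b) ∈ G.edges) i j

/-- The nodes split into two disjoint parts, with positive weights on the edges inside each part
and negative weights on the edges between the two parts. -/
def StructurallyBalanced (G : SignedNetwork n) : Prop :=
  ∃ V₁ V₂ : Set (Fin n), V₁ ∪ V₂ = Set.univ ∧ V₁ ∩ V₂ = ∅ ∧
    ∀ i j, (i, j) ∈ G.edges →
      ((i ∈ V₁ ∧ j ∈ V₁) ∨ (i ∈ V₂ ∧ j ∈ V₂) → 0 < G.W i j) ∧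
      ((i ∈ V₁ ∧ j ∈ V₂) ∨ (i ∈ V₂ ∧ j ∈ V₁) → G.W i j < 0)

/-- The signed Laplacian: `l i i = ∑ₖ W i k` and `l i j = - W i j` for `i ≠ j`. -/
def laplacian (G : SignedNetwork n) : Matrix (Fin n) (Fin n) ℝ :=
  Matrix.of fun i j => if i = j then ∑ k, G.W i k else - G.W i j

/-- The compensated Laplacian `L + diag(k)`. -/
def compensatedLaplacian (G : SignedNetwork n) (k : Fin n → ℝ) : Matrix (Fin n) (Fin n) ℝ :=
  G.laplacian + Matrix.diagonal k

/-- The vector `δ i = ∑ⱼ (|W i j| - W i j)`. -/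
def delta (G : SignedNetwork n) : Fin n → ℝ :=
  fun i => ∑ j, (|G.W i j| - G.W i j)

/-- `x` solves `x'(t) = -(L + diag k) x(t)` for `t ≥ 0` (one-sided derivative at `t = 0`). -/
def IsTrajectory (G : SignedNetwork n) (k : Fin n → ℝ) (x : ℝ → Fin n → ℝ) : Prop :=
  ∀ t : ℝ, 0 ≤ t →
    HasDerivWithinAt x (-((G.compensatedLaplacian k).mulVec (x t))) (Set.Ici 0) t

/-- Lyapunov stability of the origin for the compensated network. -/
def IsStable (G : SignedNetwork n) (k : Fin n → ℝ) : Prop :=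
  ∀ ε > 0, ∃ η > 0, ∀ x : ℝ → Fin n → ℝ, G.IsTrajectory k x → ‖x 0‖ < η →
    ∀ t : ℝ, 0 ≤ t → ‖x t‖ < ε

/-- The compensated network is unstable: the origin is not Lyapunov stable. -/
def IsUnstable (G : SignedNetwork n) (k : Fin n → ℝ) : Prop :=
  ¬ G.IsStable k

/-- Trivial consensus: every trajectory, from any initial state, converges to the origin. -/
def AchievesTrivialConsensus (G : SignedNetwork n) (k : Fin n → ℝ) : Prop :=
  ∀ x : ℝ → Fin n → ℝ, G.IsTrajectory k x → Tendsto x atTop (𝓝 0)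

end SignedNetwork

/-- A curve `x` reaches bipartite consensus: all the `|xᵢ(t)|` tend to one common `α > 0`. -/
def ReachesBipartiteConsensus {n : ℕ} (x : ℝ → Fin n → ℝ) : Prop :=
  ∃ α : ℝ, 0 < α ∧ ∀ i, Tendsto (fun t => |x t i|) atTop (𝓝 α)

/-- There are two distinct indices, at one of which `x` is larger than `y` and at the other of
which it is smaller. -/
def StrictlyIncomparable {n : ℕ} (x y : Fin n → ℝ) : Prop :=
  ∃ i j, i ≠ j ∧ x i > y i ∧ x j < y j

/-! Write `-(L + diag k) = C - s I`, with `s` so large that `C` has positive diagonal. The entrywise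
modulus `B = |C|` is nonnegative and irreducible, and its row sums are `s - (k i - δ i)`. Thus `k ≥
δ` means `B 1 ≤ s 1` and `k ≤ δ` means `B 1 ≥ s 1`, with equality excluded when `k ≠ δ`.
Irreducibility turns this into a strict inequality for the positive vector `v = B ^ m 1`: `B v ≤ r
v` with `r < s` (`exists_supersolution`), or `B v ≥ r v` with `r > s` (`exists_subsolution`).

In the first case `|C ^ m u| ≤ B ^ m |u|` makes all trajectories decay like `exp (-(s - r) t)`. In
the second, balance gives signs `σ` conjugating `C` to `B`, so trajectories from multiples of `σ v`
grow like `exp ((r - s) t)`.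

Bipartite consensus would make a trajectory converge to an equilibrium with entries of equal
modulus, and each row of the equilibrium equation then forces `k i ≤ δ i`. -/

/-- A continuous real function whose absolute value has a positive limit at infinity converges. -/
theorem exists_tendsto_of_tendsto_abs {f : ℝ → ℝ} {α : ℝ} (hf : ContinuousOn f (Set.Ici 0))
    (hα : 0 < α) (h : Tendsto (fun t => |f t|) atTop (𝓝 α)) :
    ∃ c : ℝ, |c| = α ∧ Tendsto f atTop (𝓝 c) := by
  obtain ⟨T, hT⟩ := eventually_atTop.1 (h.eventually (lt_mem_nhds hα))
  set S := max T 0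
  have hne : ∀ t ∈ Set.Ici S, f t ≠ 0 := fun t ht =>
    abs_pos.1 (hT t ((le_max_left _ _).trans ht))
  have hc : ContinuousOn f (Set.Ici S) := hf.mono (Set.Ici_subset_Ici.2 (le_max_right _ _))
  -- With no zero on `[S, ∞)`, the intermediate value theorem fixes the sign of `f` there.
  have hsign : (∀ t ∈ Set.Ici S, 0 < f t) ∨ (∀ t ∈ Set.Ici S, f t < 0) := by
    by_contra! hcon
    obtain ⟨⟨a, ha, hfa⟩, b, hb, hfb⟩ := hcon
    obtain ⟨t, ht, h0⟩ := isPreconnected_Ici.intermediate_value ha hb hc ⟨hfa, hfb⟩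
    exact hne t ht h0
  rcases hsign with hs | hs
  · refine ⟨α, abs_of_pos hα, h.congr' ?_⟩
    filter_upwards [eventually_ge_atTop S] with t ht using abs_of_pos (hs t ht)
  · refine ⟨-α, by rw [abs_neg, abs_of_pos hα], h.neg.congr' ?_⟩
    filter_upwards [eventually_ge_atTop S] with t ht
    rw [abs_of_neg (hs t ht), neg_neg]

/-- If a function and its derivative both converge at infinity, the derivative tends to zero. -/
theorem eq_zero_of_tendsto_deriv {f f' : ℝ → ℝ} {c d : ℝ}
    (hderiv : ∀ t, 0 ≤ t → HasDerivWithinAt f (f' t) (Set.Ici 0) t)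
    (hf : Tendsto f atTop (𝓝 c)) (hf' : Tendsto f' atTop (𝓝 d)) : d = 0 := by
  -- The mean value theorem on `[t, t + 1]` samples `f'` at points going to infinity, where it
  -- equals increments of `f` that tend to zero.
  have hmvt : ∀ t : ℝ, ∃ s, 0 ≤ t → t ≤ s ∧ f' s = f (t + 1) - f t := by
    intro t
    by_cases ht : 0 ≤ t
    · obtain ⟨s, hs, h⟩ := exists_hasDerivAt_eq_slope f f' (lt_add_one t)
        (fun u hu => ((hderiv u (ht.trans hu.1)).continuousWithinAt).mono
          fun w hw => ht.trans hw.1)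
        (fun u hu => (hderiv u (ht.trans hu.1.le)).hasDerivAt
          (Ici_mem_nhds (ht.trans_lt hu.1)))
      exact ⟨s, fun _ => ⟨hs.1.le, by rw [h]; ring⟩⟩
    · exact ⟨0, fun h => absurd h ht⟩
  choose s hs using hmvt
  have hs_top : Tendsto s atTop atTop :=
    tendsto_atTop_mono' _ ((eventually_ge_atTop 0).mono fun t ht => (hs t ht).1) tendsto_id
  have h1 : Tendsto (fun t => f (t + 1) - f t) atTop (𝓝 d) :=
    (hf'.comp hs_top).congr' ((eventually_ge_atTop 0).mono fun t ht => (hs t ht).2)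
  have h2 : Tendsto (fun t => f (t + 1) - f t) atTop (𝓝 (c - c)) :=
    (hf.comp (tendsto_atTop_add_const_right _ 1 tendsto_id)).sub hf
  rw [tendsto_nhds_unique h1 h2, sub_self]

/-! ### Bipartite consensus and equilibria -/

namespace SignedNetwork

variable {n : ℕ}

theorem W_self (G : SignedNetwork n) (i : Fin n) : G.W i i = 0 := by
  by_contra h
  exact G.no_self_loops i ((G.mem_edges_iff i i).2 h)

/-- Subtracting `W i j` on the diagonal too is harmless since `W i i = 0`, and it splits the matrix
as diagonal minus `W`. -/
theorem compensatedLaplacian_apply (G : SignedNetwork n) (k : Fin n → ℝ) (i j : Fin n) :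
    G.compensatedLaplacian k i j = (if i = j then ∑ m, G.W i m + k i else 0) - G.W i j := by
  by_cases h : i = j
  · subst h; simp [compensatedLaplacian, laplacian, W_self]
  · simp [compensatedLaplacian, laplacian, h]

theorem compensatedLaplacian_mulVec (G : SignedNetwork n) (k v : Fin n → ℝ) (i : Fin n) :
    (G.compensatedLaplacian k).mulVec v i = (∑ m, G.W i m + k i) * v i - ∑ j, G.W i j * v j := by
  simp [Matrix.mulVec, dotProduct, compensatedLaplacian_apply, sub_mul, Finset.sum_sub_distrib]

/-- An equilibrium whose entries have equal positive modulus forces `k ≤ δ`. -/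
theorem le_delta_of_equilibrium (G : SignedNetwork n) {k v : Fin n → ℝ} {α : ℝ} (hα : 0 < α)
    (hv : ∀ i, |v i| = α) (h : (G.compensatedLaplacian k).mulVec v = 0) : k ≤ G.delta := by
  intro i
  have hi := congrFun h i
  rw [compensatedLaplacian_mulVec, Pi.zero_apply] at hi
  have hsq : v i * v i = α * α := by rw [← abs_mul_abs_self, hv]
  -- Row `i` of the equilibrium equation is multiplied by `v i`, and `v j * v i` has modulus `α *
  -- α`.
  have hle : ∑ j, G.W i j * v j * v i ≤ ∑ j, |G.W i j| * (α * α) := by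
    refine Finset.sum_le_sum fun j _ => (le_abs_self _).trans_eq ?_
    rw [abs_mul, abs_mul, hv, hv, mul_assoc]
  rw [← Finset.sum_mul, ← Finset.sum_mul] at hle
  have hmul : ((∑ m, G.W i m) + k i) * (α * α) ≤ (∑ j, |G.W i j|) * (α * α) := by
    refine le_trans (le_of_eq ?_) hle
    rw [← hsq]
    linear_combination v i * hi
  have := le_of_mul_le_mul_right hmul (by positivity)
  rw [delta, Finset.sum_sub_distrib]
  linarith

theorem IsTrajectory.le_delta_of_reachesBipartiteConsensus {G : SignedNetwork n}
    {k : Fin n → ℝ} {x : ℝ → Fin n → ℝ} (hx : G.IsTrajectory k x)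
    (h : ReachesBipartiteConsensus x) : k ≤ G.delta := by
  obtain ⟨α, hα, hlim⟩ := h
  have hderiv : ∀ i t, 0 ≤ t → HasDerivWithinAt (fun t => x t i)
      ((-((G.compensatedLaplacian k).mulVec (x t))) i) (Set.Ici 0) t :=
    fun i t ht => hasDerivWithinAt_pi.1 (hx t ht) i
  choose v hv hxv using fun i => exists_tendsto_of_tendsto_abs
    (fun t ht => (hderiv i t ht).continuousWithinAt) hα (hlim i)
  have hxv' : Tendsto x atTop (𝓝 v) := tendsto_pi_nhds.2 hxv
  refine G.le_delta_of_equilibrium hα hv (funext fun i => ?_)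
  have hcont : Continuous fun w : Fin n → ℝ => (-((G.compensatedLaplacian k).mulVec w)) i := by
    fun_prop
  simpa using eq_zero_of_tendsto_deriv (hderiv i) (hxv i) ((hcont.tendsto v).comp hxv')

end SignedNetwork

-- Nonnegative matrices and bounds on matrix exponentials

attribute [local instance] Matrix.linftyOpNormedRing Matrix.linftyOpNormedAlgebra

namespace Matrix

theorem mulVec_le_mulVec_of_nonneg {ι : Type*} [Fintype ι] {B : Matrix ι ι ℝ} (hB : ∀ i j, 0 ≤ B i j) {u v : ι → ℝ}
    (h : u ≤ v) : B.mulVec u ≤ B.mulVec v :=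
  fun i => Finset.sum_le_sum fun j _ => mul_le_mul_of_nonneg_left (h j) (hB i j)

theorem mulVec_pos_of_entry_pos {ι : Type*} [Fintype ι] {B : Matrix ι ι ℝ} (hB : ∀ i j, 0 ≤ B i j) {u : ι → ℝ}
    (hu : 0 ≤ u) {i j : ι} (hij : 0 < B i j) (hj : 0 < u j) : 0 < B.mulVec u i :=
  Finset.sum_pos' (fun l _ => mul_nonneg (hB i l) (hu l)) ⟨j, Finset.mem_univ _, mul_pos hij hj⟩

variable {ι : Type*} [Fintype ι] [DecidableEq ι]

theorem hasSum_exp_smul_mulVec (C : Matrix ι ι ℝ) (u : ι → ℝ) (t : ℝ) (i : ι) :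
    HasSum (fun m : ℕ => t ^ m / m.factorial * (C ^ m).mulVec u i)
      ((NormedSpace.exp (t • C)).mulVec u i) := by
  have hcont : Continuous fun A : Matrix ι ι ℝ => A.mulVec u i := by fun_prop
  have h := (NormedSpace.exp_series_hasSum_exp' (𝕂 := ℝ) (t • C)).map
    (AddMonoidHom.mk' (fun A : Matrix ι ι ℝ => A.mulVec u i)
      fun A B => by simp [Matrix.add_mulVec]) hcont
  refine h.congr_fun fun m => ?_
  simp only [Function.comp_apply, AddMonoidHom.mk'_apply, smul_pow, Matrix.smul_mulVec,
    Pi.smul_apply, smul_eq_mul]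
  ring

theorem hasSum_real_exp_mul (r t : ℝ) :
    HasSum (fun m : ℕ => t ^ m / m.factorial * r ^ m) (Real.exp (t * r)) := by
  rw [Real.exp_eq_exp_ℝ]
  refine (NormedSpace.expSeries_div_hasSum_exp (t * r)).congr_fun fun m => ?_
  rw [mul_pow]; ring

/-- For `t ≥ 0` the exponential series has nonnegative coefficients, so bounds on all powers add up.
The factor `σ` serves both for two-sided bounds (`σ = ±1`) and for the signs of a balanced network.
-/
theorem exp_mul_le_exp_smul_mulVec {C : Matrix ι ι ℝ} {u v σ : ι → ℝ} {r t : ℝ} (ht : 0 ≤ t)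
    (h : ∀ (m : ℕ) i, r ^ m * v i ≤ σ i * (C ^ m).mulVec u i) (i : ι) :
    Real.exp (t * r) * v i ≤ σ i * (NormedSpace.exp (t • C)).mulVec u i := by
  refine hasSum_le (fun m => ?_) ((hasSum_real_exp_mul r t).mul_right (v i))
    ((hasSum_exp_smul_mulVec C u t i).mul_left (σ i))
  calc t ^ m / m.factorial * r ^ m * v i = t ^ m / m.factorial * (r ^ m * v i) := by ring
    _ ≤ t ^ m / m.factorial * (σ i * (C ^ m).mulVec u i) :=
      mul_le_mul_of_nonneg_left (h m i) (by positivity)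
    _ = _ := by ring

theorem abs_exp_smul_mulVec_le {C : Matrix ι ι ℝ} {u v : ι → ℝ} {r t : ℝ} (ht : 0 ≤ t)
    (h : ∀ (m : ℕ) i, |(C ^ m).mulVec u i| ≤ r ^ m * v i) (i : ι) :
    |(NormedSpace.exp (t • C)).mulVec u i| ≤ Real.exp (t * r) * v i := by
  have h1 := exp_mul_le_exp_smul_mulVec (C := C) (u := u) (v := -v) (σ := 1) (r := r) ht
    (fun m i => by simpa using neg_le_of_abs_le (h m i)) i
  have h2 := exp_mul_le_exp_smul_mulVec (C := C) (u := u) (v := -v) (σ := -1) (r := r) ht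
    (fun m i => by simpa using le_of_abs_le (h m i)) i
  simp only [Pi.neg_apply, Pi.one_apply, mul_neg, one_mul, neg_mul] at h1 h2
  exact abs_le.2 ⟨h1, by linarith⟩

theorem pow_mulVec_succ (B : Matrix ι ι ℝ) (m : ℕ) (u : ι → ℝ) :
    (B ^ (m + 1)).mulVec u = B.mulVec ((B ^ m).mulVec u) := by
  rw [pow_succ', Matrix.mulVec_mulVec]

theorem pow_mulVec_nonneg {B : Matrix ι ι ℝ} (hB : ∀ i j, 0 ≤ B i j) {u : ι → ℝ}
    (hu : 0 ≤ u) (m : ℕ) : 0 ≤ (B ^ m).mulVec u := by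
  induction m with
  | zero => simpa using hu
  | succ m ih =>
    rw [pow_mulVec_succ]
    simpa using mulVec_le_mulVec_of_nonneg hB ih

theorem pow_mulVec_pos {B : Matrix ι ι ℝ} (hB : ∀ i j, 0 ≤ B i j) (hdiag : ∀ i, 0 < B i i)
    {u : ι → ℝ} (hu : ∀ i, 0 < u i) (m : ℕ) (i : ι) : 0 < (B ^ m).mulVec u i := by
  induction m generalizing i with
  | zero => simpa using hu i
  | succ m ih =>
    rw [pow_mulVec_succ]
    exact mulVec_pos_of_entry_pos hB (fun j => (ih j).le) (hdiag i) (ih i)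

/-- Powers of an irreducible nonnegative matrix with positive diagonal map a nonzero nonnegative
vector to positive vectors. -/
theorem exists_pow_mulVec_pos {B : Matrix ι ι ℝ} (hB : ∀ i j, 0 ≤ B i j)
    (hdiag : ∀ i, 0 < B i i) (hconn : ∀ i j, Relation.ReflTransGen (fun a b => 0 < B a b) i j)
    {u : ι → ℝ} (hu : 0 ≤ u) (hu0 : u ≠ 0) : ∃ m, ∀ i, 0 < (B ^ m).mulVec u i := by
  obtain ⟨j, hj⟩ := Function.ne_iff.1 hu0
  have hj : 0 < u j := lt_of_le_of_ne (hu j) (Ne.symm hj)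
  -- Positivity at all later exponents, which the positive diagonal ensures, allows one exponent to
  -- serve every index.
  have key : ∀ i, ∃ m, ∀ m' ≥ m, 0 < (B ^ m').mulVec u i := by
    intro i
    induction hconn i j using Relation.ReflTransGen.head_induction_on with
    | refl =>
      refine ⟨0, fun m' _ => ?_⟩
      induction m' with
      | zero => simpa using hj
      | succ m ih =>
        rw [pow_mulVec_succ]
        exact mulVec_pos_of_entry_pos hB (pow_mulVec_nonneg hB hu m) (hdiag j) (ih (Nat.zero_le _))
    | head hab _ ih =>
      obtain ⟨m, hm⟩ := ih
      refine ⟨m + 1, fun m' hm' => ?_⟩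
      obtain ⟨p, rfl⟩ := Nat.exists_eq_add_of_le' hm'
      rw [← add_assoc, pow_mulVec_succ]
      exact mulVec_pos_of_entry_pos hB (pow_mulVec_nonneg hB hu _) hab (hm _ (by omega))
  choose m hm using key
  exact ⟨Finset.univ.sup m, fun i => hm i _ (Finset.le_sup (Finset.mem_univ i))⟩

theorem pow_mul_le_pow_mulVec {B : Matrix ι ι ℝ} (hB : ∀ i j, 0 ≤ B i j) {v : ι → ℝ} {r : ℝ}
    (hr : 0 ≤ r) (h : r • v ≤ B.mulVec v) (m : ℕ) : r ^ m • v ≤ (B ^ m).mulVec v := by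
  induction m with
  | zero => simp
  | succ m ih =>
    rw [pow_mulVec_succ]
    refine le_trans ?_ (mulVec_le_mulVec_of_nonneg hB ih)
    rw [Matrix.mulVec_smul, pow_succ, mul_smul]
    exact smul_le_smul_of_nonneg_left h (pow_nonneg hr m)

theorem pow_mulVec_le_pow_mul {B : Matrix ι ι ℝ} (hB : ∀ i j, 0 ≤ B i j) {v : ι → ℝ} {r : ℝ}
    (hr : 0 ≤ r) (h : B.mulVec v ≤ r • v) (m : ℕ) : (B ^ m).mulVec v ≤ r ^ m • v := by
  induction m with
  | zero => simp
  | succ m ih =>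
    rw [pow_mulVec_succ]
    refine (mulVec_le_mulVec_of_nonneg hB ih).trans ?_
    rw [Matrix.mulVec_smul, pow_succ, mul_smul]
    exact smul_le_smul_of_nonneg_left h (pow_nonneg hr m)

theorem abs_pow_mulVec_le {C : Matrix ι ι ℝ} {u v : ι → ℝ} (h : ∀ i, |u i| ≤ v i) (m : ℕ)
    (i : ι) : |(C ^ m).mulVec u i| ≤ ((C.map abs) ^ m).mulVec v i := by
  induction m generalizing i with
  | zero => simpa using h i
  | succ m ih =>
    rw [pow_mulVec_succ, pow_mulVec_succ]
    refine (Finset.abs_sum_le_sum_abs _ _).trans (Finset.sum_le_sum fun j _ => ?_)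
    rw [abs_mul]
    exact mul_le_mul_of_nonneg_left (ih j) (abs_nonneg _)

/-- The hypothesis is the intertwining `C Σ = Σ B` with `Σ = diag σ`, which passes to powers. -/
theorem pow_mulVec_gauge {B C : Matrix ι ι ℝ} {σ : ι → ℝ} (h : ∀ i j, C i j * σ j = σ i * B i j)
    (v : ι → ℝ) (m : ℕ) : (C ^ m).mulVec (σ * v) = σ * (B ^ m).mulVec v := by
  induction m with
  | zero => simp
  | succ m ih =>
    rw [pow_mulVec_succ, pow_mulVec_succ, ih]
    ext i
    rw [Pi.mul_apply, Matrix.mulVec, Matrix.mulVec, dotProduct, dotProduct, Finset.mul_sum]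
    refine Finset.sum_congr rfl fun j _ => ?_
    rw [Pi.mul_apply, ← mul_assoc, h, mul_assoc]

end Matrix

/-- Strict entrywise inequality with a positive vector leaves a uniform margin. -/
theorem exists_pos_smul_le {ι : Type*} [Finite ι] {u v : ι → ℝ} (hu : ∀ i, 0 < u i) :
    ∃ ε : ℝ, 0 < ε ∧ ε • v ≤ u := by
  have h : ∀ᶠ ε in 𝓝[>] (0 : ℝ), ∀ i, ε * v i < u i := by
    refine eventually_all.2 fun i => ?_
    have hc : Tendsto (fun ε : ℝ => ε * v i) (𝓝[>] 0) (𝓝 (0 * v i)) :=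
      (tendsto_id.mul_const _).mono_left nhdsWithin_le_nhds
    rw [zero_mul] at hc
    exact hc.eventually (gt_mem_nhds (hu i))
  obtain ⟨ε, hε, hpos⟩ := (h.and self_mem_nhdsWithin).exists
  exact ⟨ε, hpos, fun i => (hε i).le⟩

/-! ### Strict super- and subsolutions, and the derivative of the exponential flow -/

namespace Matrix

variable {ι : Type*} [Fintype ι] [DecidableEq ι]

/-- The defect `s 1 - B 1` is nonnegative and nonzero, so some `B ^ m` makes it positive. As `B ^ m`
commutes with `B`, the image is the defect of `v = B ^ m 1`, which exceeds some `ε v`; then `r = s -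
ε`. -/
theorem exists_supersolution {B : Matrix ι ι ℝ} (hB : ∀ i j, 0 ≤ B i j)
    (hdiag : ∀ i, 0 < B i i) (hconn : ∀ i j, Relation.ReflTransGen (fun a b => 0 < B a b) i j)
    {s : ℝ} (h : B.mulVec 1 ≤ s • 1) (hne : B.mulVec 1 ≠ s • 1) :
    ∃ v : ι → ℝ, (∀ i, 0 < v i) ∧ ∃ r, 0 ≤ r ∧ r < s ∧ B.mulVec v ≤ r • v := by
  obtain ⟨m, hm⟩ := exists_pow_mulVec_pos hB hdiag hconn (sub_nonneg.2 h)
    (sub_ne_zero.2 hne.symm)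
  have hv := pow_mulVec_pos hB hdiag (u := 1) (fun _ => one_pos) m
  obtain ⟨ε, hε, hle⟩ := exists_pos_smul_le (v := (B ^ m).mulVec 1) hm
  obtain ⟨i₀, -⟩ := Function.ne_iff.1 hne
  have hBv : B.mulVec ((B ^ m).mulVec 1) ≤ (s - ε) • (B ^ m).mulVec 1 := by
    rw [Matrix.mulVec_sub, Matrix.mulVec_smul, Matrix.mulVec_mulVec, ← pow_succ] at hle
    rw [← pow_mulVec_succ, sub_smul]
    exact le_sub_comm.1 hle
  refine ⟨_, hv, s - ε, ?_, by linarith, hBv⟩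
  -- `0 ≤ B v ≤ (s - ε) v` at one index gives `r ≥ 0`, needed to iterate the bound.
  have h0 : 0 ≤ (s - ε) * (B ^ m).mulVec 1 i₀ := by
    refine le_trans ?_ (hBv i₀)
    rw [← pow_mulVec_succ]
    exact pow_mulVec_nonneg hB zero_le_one _ _
  exact nonneg_of_mul_nonneg_left h0 (hv i₀)

theorem exists_subsolution {B : Matrix ι ι ℝ} (hB : ∀ i j, 0 ≤ B i j)
    (hdiag : ∀ i, 0 < B i i) (hconn : ∀ i j, Relation.ReflTransGen (fun a b => 0 < B a b) i j)
    {s : ℝ} (h : s • 1 ≤ B.mulVec 1) (hne : B.mulVec 1 ≠ s • 1) :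
    ∃ v : ι → ℝ, (∀ i, 0 < v i) ∧ ∃ r, s < r ∧ r • v ≤ B.mulVec v := by
  obtain ⟨m, hm⟩ := exists_pow_mulVec_pos hB hdiag hconn (sub_nonneg.2 h) (sub_ne_zero.2 hne)
  have hv := pow_mulVec_pos hB hdiag (u := 1) (fun _ => one_pos) m
  obtain ⟨ε, hε, hle⟩ := exists_pos_smul_le (v := (B ^ m).mulVec 1) hm
  refine ⟨_, hv, s + ε, by linarith, ?_⟩
  rw [Matrix.mulVec_sub, Matrix.mulVec_smul, Matrix.mulVec_mulVec, ← pow_succ] at hle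
  rw [← pow_mulVec_succ, add_smul]
  exact le_sub_iff_add_le'.1 hle

theorem hasDerivAt_exp_smul_mulVec (C : Matrix ι ι ℝ) (u : ι → ℝ) (s t : ℝ) :
    HasDerivAt (fun t => Real.exp (-(t * s)) • (NormedSpace.exp (t • C)).mulVec u)
      ((C - s • 1).mulVec (Real.exp (-(t * s)) • (NormedSpace.exp (t • C)).mulVec u)) t := by
  have h1 := hasDerivAt_exp_smul_const' (𝕂 := ℝ) C t
  let Φ : Matrix ι ι ℝ →L[ℝ] (ι → ℝ) := LinearMap.toContinuousLinearMap
    { toFun := fun A => A.mulVec u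
      map_add' := fun A B => Matrix.add_mulVec A B u
      map_smul' := fun c A => Matrix.smul_mulVec c A u }
  have h2 : HasDerivAt (fun t : ℝ => (NormedSpace.exp (t • C)).mulVec u)
      ((C * NormedSpace.exp (t • C)).mulVec u) t := Φ.hasFDerivAt.comp_hasDerivAt t h1
  have h3 : HasDerivAt (fun t => Real.exp (-(t * s))) (Real.exp (-(t * s)) * -s) t := by
    simpa using (((hasDerivAt_id t).mul_const s).neg).exp
  refine (h3.smul h2).congr_deriv ?_
  rw [Matrix.sub_mulVec, Matrix.mulVec_smul, Matrix.mulVec_mulVec, Matrix.smul_mulVec,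
    Matrix.one_mulVec]
  module

end Matrix

/-! ### Trajectories of the compensated network: decay and instability -/

namespace SignedNetwork

variable {n : ℕ}

/-- The shifted matrix `s I - (L + diag k)`. -/
def shifted (G : SignedNetwork n) (k : Fin n → ℝ) (s : ℝ) : Matrix (Fin n) (Fin n) ℝ :=
  s • 1 - G.compensatedLaplacian k

theorem shifted_apply (G : SignedNetwork n) (k : Fin n → ℝ) (s : ℝ) (i j : Fin n) :
    G.shifted k s i j = (if i = j then s - (∑ m, G.W i m + k i) else 0) + G.W i j := by
  rw [shifted, Matrix.sub_apply, compensatedLaplacian_apply, Matrix.smul_apply, Matrix.one_apply]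
  split_ifs <;> simp only [smul_eq_mul] <;> ring

/-- The candidate solution `t ↦ exp (-(L + diag k) t) u`. -/
noncomputable def flow (G : SignedNetwork n) (k : Fin n → ℝ) (s : ℝ) (u : Fin n → ℝ) (t : ℝ) :
    Fin n → ℝ :=
  Real.exp (-(t * s)) • (NormedSpace.exp (t • G.shifted k s)).mulVec u

theorem flow_zero (G : SignedNetwork n) (k : Fin n → ℝ) (s : ℝ) (u : Fin n → ℝ) :
    G.flow k s u 0 = u := by
  simp [flow]

theorem hasDerivAt_flow (G : SignedNetwork n) (k : Fin n → ℝ) (s : ℝ) (u : Fin n → ℝ) (t : ℝ) :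
    HasDerivAt (G.flow k s u) (-((G.compensatedLaplacian k).mulVec (G.flow k s u t))) t := by
  refine (Matrix.hasDerivAt_exp_smul_mulVec (G.shifted k s) u s t).congr_deriv ?_
  rw [shifted, sub_sub_cancel_left, Matrix.neg_mulVec]
  rfl

theorem isTrajectory_flow (G : SignedNetwork n) (k : Fin n → ℝ) (s : ℝ) (u : Fin n → ℝ) :
    G.IsTrajectory k (G.flow k s u) :=
  fun t _ => (G.hasDerivAt_flow k s u t).hasDerivWithinAt

/-- Uniqueness for a Lipschitz vector field carries bounds on the explicit flow over to every
trajectory. -/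
theorem IsTrajectory.eq_flow {G : SignedNetwork n} {k : Fin n → ℝ} {x : ℝ → Fin n → ℝ}
    (hx : G.IsTrajectory k x) (s : ℝ) {t : ℝ} (ht : 0 ≤ t) : x t = G.flow k s (x 0) t := by
  let Φ : (Fin n → ℝ) →L[ℝ] (Fin n → ℝ) :=
    LinearMap.toContinuousLinearMap (-(G.compensatedLaplacian k).mulVecLin)
  refine ODE_solution_unique (v := fun _ => Φ) (a := 0) (b := t) (fun _ => Φ.lipschitz)
    (fun r hr => (hx r hr.1).continuousWithinAt.mono fun _ hw => hw.1)
    (fun r hr => (hx r hr.1).mono (Set.Ici_subset_Ici.2 hr.1))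
    (fun r _ => (G.hasDerivAt_flow k s _ r).continuousAt.continuousWithinAt)
    (fun r _ => (G.hasDerivAt_flow k s _ r).hasDerivWithinAt)
    (G.flow_zero k s _).symm (Set.right_mem_Icc.2 ht)

theorem exists_shift (G : SignedNetwork n) (k : Fin n → ℝ) :
    ∃ s, 0 ≤ s ∧ ∀ i, 0 < s - (∑ m, G.W i m + k i) := by
  refine ⟨1 + ∑ i, |∑ m, G.W i m + k i|, by positivity, fun i => ?_⟩
  have h := Finset.single_le_sum (f := fun i => |∑ m, G.W i m + k i|)
    (fun i _ => abs_nonneg _) (Finset.mem_univ i)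
  have := (le_abs_self _).trans h
  linarith

theorem abs_shifted_apply {G : SignedNetwork n} {k : Fin n → ℝ} {s : ℝ}
    (hs : ∀ i, 0 < s - (∑ m, G.W i m + k i)) (i j : Fin n) :
    (G.shifted k s).map abs i j =
      (if i = j then s - (∑ m, G.W i m + k i) else 0) + |G.W i j| := by
  rw [Matrix.map_apply, shifted_apply]
  split_ifs with h
  · subst h; simp [W_self, abs_of_pos (hs i)]
  · simp

/-- This is where `δ` enters: replacing `W` by `|W|` raises the `i`-th row sum by exactly `δ i`. -/
theorem abs_shifted_mulVec_one {G : SignedNetwork n} {k : Fin n → ℝ} {s : ℝ}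
    (hs : ∀ i, 0 < s - (∑ m, G.W i m + k i)) (i : Fin n) :
    ((G.shifted k s).map abs).mulVec 1 i = s - (k i - G.delta i) := by
  simp only [Matrix.mulVec, dotProduct, abs_shifted_apply hs, Pi.one_apply, mul_one,
    Finset.sum_add_distrib, Finset.sum_ite_eq, Finset.mem_univ, if_true, delta,
    Finset.sum_sub_distrib]
  ring

theorem abs_shifted_nonneg (G : SignedNetwork n) (k : Fin n → ℝ) (s : ℝ) (i j : Fin n) :
    0 ≤ (G.shifted k s).map abs i j :=
  abs_nonneg _

theorem abs_shifted_diag_pos {G : SignedNetwork n} {k : Fin n → ℝ} {s : ℝ}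
    (hs : ∀ i, 0 < s - (∑ m, G.W i m + k i)) (i : Fin n) :
    0 < (G.shifted k s).map abs i i := by
  rw [abs_shifted_apply hs, if_pos rfl]
  exact add_pos_of_pos_of_nonneg (hs i) (abs_nonneg _)

theorem StronglyConnected.abs_shifted {G : SignedNetwork n} (hconn : G.StronglyConnected)
    {k : Fin n → ℝ} {s : ℝ} (hs : ∀ i, 0 < s - (∑ m, G.W i m + k i)) (i j : Fin n) :
    Relation.ReflTransGen (fun a b => 0 < (G.shifted k s).map abs a b) i j := by
  refine Relation.ReflTransGen.mono (fun a b hab => ?_) _ _ (hconn i j)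
  rw [abs_shifted_apply hs]
  refine add_pos_of_nonneg_of_pos ?_ (abs_pos.2 ((G.mem_edges_iff a b).1 hab))
  split_ifs
  exacts [(hs a).le, le_rfl]

theorem abs_shifted_mulVec_one_ne {G : SignedNetwork n} {k : Fin n → ℝ} {s : ℝ}
    (hs : ∀ i, 0 < s - (∑ m, G.W i m + k i)) (hne : k ≠ G.delta) :
    ((G.shifted k s).map abs).mulVec 1 ≠ s • 1 := by
  refine fun h => hne (funext fun i => ?_)
  have hi := congrFun h i
  rw [abs_shifted_mulVec_one hs, Pi.smul_apply, Pi.one_apply, smul_eq_mul, mul_one] at hi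
  linarith

theorem StronglyConnected.achievesTrivialConsensus {G : SignedNetwork n}
    (hconn : G.StronglyConnected) {k : Fin n → ℝ} (hk : G.delta ≤ k) (hne : k ≠ G.delta) :
    G.AchievesTrivialConsensus k := by
  intro x hx
  obtain ⟨s, -, hs⟩ := G.exists_shift k
  obtain ⟨v, hv, r, hr0, hrs, hBv⟩ := Matrix.exists_supersolution (G.abs_shifted_nonneg k s)
    (abs_shifted_diag_pos hs) (hconn.abs_shifted hs)
    (fun i => by
      rw [abs_shifted_mulVec_one hs, Pi.smul_apply, Pi.one_apply, smul_eq_mul, mul_one]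
      linarith [hk i])
    (abs_shifted_mulVec_one_ne hs hne)
  -- Since `v` is positive, the multiple `ε⁻¹ • v` dominates the initial state entrywise.
  obtain ⟨ε, hε, hle⟩ := exists_pos_smul_le (v := fun i => |x 0 i|) hv
  have hx0 : ∀ i, |x 0 i| ≤ (ε⁻¹ • v) i := fun i => by
    have := hle i
    simp only [Pi.smul_apply, smul_eq_mul] at this ⊢
    rwa [← div_eq_inv_mul, le_div_iff₀' hε]
  have hpow : ∀ (m : ℕ) i, |((G.shifted k s) ^ m).mulVec (x 0) i| ≤ r ^ m * (ε⁻¹ • v) i :=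
    fun m i => (Matrix.abs_pow_mulVec_le hx0 m i).trans
      (Matrix.pow_mulVec_le_pow_mul (G.abs_shifted_nonneg k s) hr0 (by
        rw [Matrix.mulVec_smul, smul_comm]
        exact smul_le_smul_of_nonneg_left hBv (inv_nonneg.2 hε.le)) m i)
  refine tendsto_pi_nhds.2 fun i => squeeze_zero_norm'
    (a := fun t => Real.exp (-(t * (s - r))) * (ε⁻¹ • v) i) ?_ ?_
  · filter_upwards [eventually_ge_atTop 0] with t ht
    rw [hx.eq_flow s ht, Real.norm_eq_abs, flow, Pi.smul_apply, smul_eq_mul, abs_mul,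
      Real.abs_exp]
    refine (mul_le_mul_of_nonneg_left (Matrix.abs_exp_smul_mulVec_le ht hpow i)
      (Real.exp_nonneg _)).trans_eq ?_
    rw [← mul_assoc, ← Real.exp_add]
    congr 2
    ring
  · have h : Tendsto (fun t : ℝ => t * (s - r)) atTop atTop :=
      tendsto_id.atTop_mul_const (sub_pos.2 hrs)
    simpa using (Real.tendsto_exp_neg_atTop_nhds_zero.comp h).mul_const ((ε⁻¹ • v) i)

/-- The signs `±1` that turn a structurally balanced adjacency matrix into a nonnegative one. -/
theorem StructurallyBalanced.exists_signs {G : SignedNetwork n} (hbal : G.StructurallyBalanced) :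
    ∃ σ : Fin n → ℝ, (∀ i, |σ i| = 1) ∧ ∀ i j, G.W i j * σ j = σ i * |G.W i j| := by
  classical
  obtain ⟨V₁, V₂, hU, hI, h⟩ := hbal
  have h₂ : ∀ i, i ∉ V₁ → i ∈ V₂ := fun i hi =>
    ((Set.mem_union i V₁ V₂).1 (hU ▸ Set.mem_univ i)).resolve_left hi
  refine ⟨fun i => if i ∈ V₁ then 1 else -1, fun i => by by_cases hi : i ∈ V₁ <;> simp [hi], fun i j => ?_⟩
  by_cases h0 : G.W i j = 0
  · simp [h0]
  obtain ⟨hpos, hneg⟩ := h i j ((G.mem_edges_iff i j).2 h0)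
  by_cases hi : i ∈ V₁ <;> by_cases hj : j ∈ V₁ <;> simp only [hi, hj, if_true, if_false]
  · rw [abs_of_pos (hpos (Or.inl ⟨hi, hj⟩))]; ring
  · rw [abs_of_neg (hneg (Or.inl ⟨hi, h₂ j hj⟩))]; ring
  · rw [abs_of_neg (hneg (Or.inr ⟨h₂ i hi, hj⟩))]; ring
  · rw [abs_of_pos (hpos (Or.inr ⟨h₂ i hi, h₂ j hj⟩))]; ring

theorem StronglyConnected.isUnstable {G : SignedNetwork n} (hconn : G.StronglyConnected)
    (hbal : G.StructurallyBalanced) {k : Fin n → ℝ} (hk : k ≤ G.delta) (hne : k ≠ G.delta) :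
    G.IsUnstable k := by
  intro hstab
  obtain ⟨s, hs0, hs⟩ := G.exists_shift k
  obtain ⟨σ, hσ, hW⟩ := hbal.exists_signs
  obtain ⟨v, hv, r, hsr, hBv⟩ := Matrix.exists_subsolution (G.abs_shifted_nonneg k s)
    (abs_shifted_diag_pos hs) (hconn.abs_shifted hs)
    (fun i => by
      rw [abs_shifted_mulVec_one hs, Pi.smul_apply, Pi.one_apply, smul_eq_mul, mul_one]
      linarith [hk i])
    (abs_shifted_mulVec_one_ne hs hne)
  obtain ⟨i₀, -⟩ := Function.ne_iff.1 hne
  obtain ⟨η, hη, hbound⟩ := hstab 1 one_pos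
  -- The escaping trajectory starts at `c • (σ * v)`, a multiple small enough for the stability
  -- radius `η`.
  obtain ⟨c, hc, hcη⟩ : ∃ c : ℝ, 0 < c ∧ ‖c • (σ * v)‖ < η := by
    have hcont : Tendsto (fun c : ℝ => ‖c • (σ * v)‖) (𝓝[>] 0) (𝓝 ‖(0 : ℝ) • (σ * v)‖) :=
      (tendsto_id.smul_const _).norm.mono_left nhdsWithin_le_nhds
    rw [zero_smul, norm_zero] at hcont
    obtain ⟨c, hlt, hpos⟩ := ((hcont.eventually (gt_mem_nhds hη)).and self_mem_nhdsWithin).exists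
    exact ⟨c, hpos, hlt⟩
  have hgauge : ∀ i j, G.shifted k s i j * σ j = σ i * (G.shifted k s).map abs i j := by
    intro i j
    rw [abs_shifted_apply hs, shifted_apply, add_mul, mul_add, hW]
    split_ifs with hij
    · subst hij; ring
    · ring
  have hpow : ∀ (m : ℕ) i, r ^ m * (c • v) i ≤
      σ i * ((G.shifted k s) ^ m).mulVec (c • (σ * v)) i := by
    intro m i
    have hσσ : σ i * σ i = 1 := by rw [← abs_mul_abs_self, hσ, one_mul]
    rw [Matrix.mulVec_smul, Matrix.pow_mulVec_gauge hgauge, Pi.smul_apply, Pi.smul_apply,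
      Pi.mul_apply, smul_eq_mul, smul_eq_mul, mul_left_comm (σ i), ← mul_assoc (σ i), hσσ, one_mul,
      mul_left_comm]
    exact mul_le_mul_of_nonneg_left (Matrix.pow_mul_le_pow_mulVec (G.abs_shifted_nonneg k s)
      (hs0.trans hsr.le) hBv m i) hc.le
  -- Stability with `ε = 1` would cap a coordinate that grows at least like `exp (t * (r - s))`.
  have hgrow : ∀ t, 0 ≤ t → Real.exp (t * (r - s)) * (c • v) i₀ < 1 := by
    intro t ht
    have hlt := hbound _ (G.isTrajectory_flow k s (c • (σ * v))) (by rwa [flow_zero]) t ht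
    refine lt_of_le_of_lt ?_ ((norm_le_pi_norm _ i₀).trans_lt hlt)
    have hle := mul_le_mul_of_nonneg_left (Matrix.exp_mul_le_exp_smul_mulVec ht hpow i₀)
      (Real.exp_nonneg (-(t * s)))
    calc Real.exp (t * (r - s)) * (c • v) i₀
        = Real.exp (-(t * s)) * (Real.exp (t * r) * (c • v) i₀) := by
          rw [← mul_assoc, ← Real.exp_add]; congr 2; ring
      _ ≤ _ := hle
      _ = σ i₀ * G.flow k s (c • (σ * v)) t i₀ := by
          rw [flow, Pi.smul_apply, smul_eq_mul]; ring
      _ ≤ |σ i₀ * G.flow k s (c • (σ * v)) t i₀| := le_abs_self _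
      _ = _ := by rw [abs_mul, hσ, one_mul, Real.norm_eq_abs]
  have hcv : 0 < (c • v) i₀ := mul_pos hc (hv i₀)
  have htop : Tendsto (fun t : ℝ => Real.exp (t * (r - s)) * (c • v) i₀) atTop atTop :=
    (Real.tendsto_exp_atTop.comp
      (tendsto_id.atTop_mul_const (sub_pos.2 hsr))).atTop_mul_const hcv
  obtain ⟨t, h1, h0⟩ := ((htop.eventually_ge_atTop 1).and (eventually_ge_atTop 0)).exists
  exact (hgrow t h0).not_ge h1

end SignedNetwork

theorem mainTheorem3 {n : ℕ} (G : SignedNetwork n)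
    (hbal : G.StructurallyBalanced) (hconn : G.StronglyConnected) (k : Fin n → ℝ) :
    (k ≤ G.delta → k ≠ G.delta → G.IsUnstable k) ∧
    (k ≥ G.delta → k ≠ G.delta → G.AchievesTrivialConsensus k) ∧
    (StrictlyIncomparable k G.delta →
      ∀ x : ℝ → Fin n → ℝ, G.IsTrajectory k x → ¬ ReachesBipartiteConsensus x) := by
  refine ⟨hconn.isUnstable hbal, hconn.achievesTrivialConsensus, ?_⟩
  rintro ⟨i, -, -, hi, -⟩ x hx hbip
  exact (hx.le_delta_of_reachesBipartiteConsensus hbip i).not_gt hi
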